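/- Let $R$ be a commutative noetherian ring with $1$, let $n\ge 0$, and let $I\unlhd R[[t]][x_1,\ldots,x_n]$ be an $\mathbf{x}$-homogeneous ideal, i.e. an ideal generated by elements that are homogeneous as polynomials in $\mathbf{x}=(x_1,\ldots,x_n)$ over $R[[t]]$. For $w=(w_0,\ldots,w_n)\in\mathbb{R}_{<0}\times\mathbb{R}^n$ and $f=\sum_{\beta,\alpha}c_{\beta,\alpha}t^\beta\mathbf{x}^\alpha\in R[[t]][\mathbf{x}]$ let $\operatorname{in}_w(f)\in R[t,\mathbf{x}]$ be the sum of those terms $c_{\beta,\alpha}t^\beta\mathbf{x}^\alpha$ with $c_{\beta,\alpha}\neq 0$ for which $w\cdot(\beta,\alpha)$ is maximal, let $\operatorname{in}_w(I)=\langle \operatorname{in}_w(f)\mid f\in I\rangle\unlhd R[t,\mathbf{x}]$, and let $$C_w(I)=\overline{\{w'\in\mathbb{R}_{<0}\times\mathbb{R}^n\mid \operatorname{in}_{w'}(I)=\operatorname{in}_w(I)\}}\subseteq\mathbb{R}_{\le 0}\times\mathbb{R}^n$$ (closure in the Euclidean topology). The sets $C_w(I)$ with $w\in\mathbb{R}_{<0}\times\mathbb{R}^n$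 are called the interior Gröbner cones of $I$. A face of a cone $C\subseteq\mathbb{R}^{n+1}$ is a set of the form $\{x\in C\mid \ell(x)=0\}$, where $\ell$ is a linear functional on $\mathbb{R}^{n+1}$ that is nonnegative on $C$. Let $u,v\in\mathbb{R}_{<0}\times\mathbb{R}^n$ be such that $C_u(I)\cap C_v(I)\nsubseteq\{0\}\times\mathbb{R}^n$. Then $C_u(I)\cap C_v(I)$ is an interior Gröbner cone of $I$, and it is a face of both $C_u(I)$ and $C_v(I)$. -/

import Mathlib

open scoped BigOperators

namespace GroebnerFan

/-- The coefficient of `t ^ (e 0) * x ^ (e 1, …, e n)` in an element of `R⟦t⟧[x₁, …, xₙ]`.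
Exponents of monomials in `(t, x₁, …, xₙ)` are finitely supported maps on `Fin (n + 1)`, with
the exponent of `t` in position `0`. -/
noncomputable def mixedCoeff {R : Type*} [CommRing R] {n : ℕ}
    (f : MvPolynomial (Fin n) (PowerSeries R)) (e : Fin (n + 1) →₀ ℕ) : R :=
  PowerSeries.coeff (e 0) (MvPolynomial.coeff e.tail f)

/-- The ideal `I` of `R⟦t⟧[x]` is generated by elements that are homogeneous in `x`. -/
def IsXHomogeneous {R : Type*} [CommRing R] {n : ℕ}
    (I : Ideal (MvPolynomial (Fin n) (PowerSeries R))) : Prop :=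
  ∃ S : Set (MvPolynomial (Fin n) (PowerSeries R)),
    (∀ f ∈ S, ∃ d : ℕ, f.IsHomogeneous d) ∧ I = Ideal.span S

/-- The scalar product of a weight vector with an exponent vector. -/
def weightedDegree {n : ℕ} (w : Fin (n + 1) → ℝ) (e : Fin (n + 1) →₀ ℕ) : ℝ :=
  ∑ i, w i * (e i : ℝ)

/-- The exponents occurring in `f` whose `w`-weighted degree is maximal among all exponents
occurring in `f`. -/
def initialSupport {R : Type*} [CommRing R] {n : ℕ} (w : Fin (n + 1) → ℝ)
    (f : MvPolynomial (Fin n) (PowerSeries R)) : Set (Fin (n + 1) →₀ ℕ) :=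
  {e | mixedCoeff f e ≠ 0 ∧
    ∀ e', mixedCoeff f e' ≠ 0 → weightedDegree w e' ≤ weightedDegree w e}

/-- The initial form of `f` with respect to `w`, an element of the polynomial ring
`R[t, x₁, …, xₙ]` (variable `0` is `t`). It is used only for `w 0 < 0`, where the sum is finite
by `initialSupport_finite`. -/
noncomputable def initialForm {R : Type*} [CommRing R] {n : ℕ} (w : Fin (n + 1) → ℝ)
    (f : MvPolynomial (Fin n) (PowerSeries R)) : MvPolynomial (Fin (n + 1)) R :=
  ∑ᶠ e ∈ initialSupport w f, MvPolynomial.monomial e (mixedCoeff f e)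

theorem initialSupport_finite {R : Type*} [CommRing R] {n : ℕ} {w : Fin (n + 1) → ℝ}
    (hw : w 0 < 0) (f : MvPolynomial (Fin n) (PowerSeries R)) :
    (initialSupport w f).Finite := by
  refine Set.Finite.of_injOn (f := Finsupp.tail) (t := (f.support : Set (Fin n →₀ ℕ))) ?_ ?_
    f.support.finite_toSet
  · intro e he
    simp only [Finset.mem_coe, MvPolynomial.mem_support_iff]
    intro h0
    exact he.1 (by simp [mixedCoeff, h0])
  · intro e he e' he' h
    have hdeg : weightedDegree w e = weightedDegree w e' :=
      le_antisymm (he'.2 e he.1) (he.2 e' he'.1)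
    have hs : ∀ i : Fin n, e i.succ = e' i.succ := fun i => by
      simpa [Finsupp.tail_apply] using DFunLike.congr_fun h i
    have h0 : (e 0 : ℝ) = e' 0 := by
      simp only [weightedDegree, Fin.sum_univ_succ, hs] at hdeg
      exact mul_left_cancel₀ hw.ne (add_right_cancel hdeg)
    ext i
    refine Fin.cases ?_ hs i
    exact_mod_cast h0

open scoped Classical in
theorem coeff_initialForm {R : Type*} [CommRing R] {n : ℕ} {w : Fin (n + 1) → ℝ}
    (hw : w 0 < 0) (f : MvPolynomial (Fin n) (PowerSeries R)) (e : Fin (n + 1) →₀ ℕ) :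
    MvPolynomial.coeff e (initialForm w f) =
      if e ∈ initialSupport w f then mixedCoeff f e else 0 := by
  rw [initialForm, finsum_mem_eq_finite_toFinset_sum _ (initialSupport_finite hw f),
    MvPolynomial.coeff_sum]
  simp [MvPolynomial.coeff_monomial]

/-- The initial ideal of `I` with respect to `w`, an ideal of `R[t, x]`. -/
noncomputable def initialIdeal {R : Type*} [CommRing R] {n : ℕ}
    (I : Ideal (MvPolynomial (Fin n) (PowerSeries R))) (w : Fin (n + 1) → ℝ) :
    Ideal (MvPolynomial (Fin (n + 1)) R) :=
  Ideal.span {p | ∃ f ∈ I, p = initialForm w f}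

/-- For `w 0 < 0`, the interior Gröbner cone of `I` at `w`: the Euclidean closure of the set of
all weight vectors in the open lower half space that have the same initial ideal as `w`. -/
def groebnerCone {R : Type*} [CommRing R] {n : ℕ}
    (I : Ideal (MvPolynomial (Fin n) (PowerSeries R))) (w : Fin (n + 1) → ℝ) :
    Set (Fin (n + 1) → ℝ) :=
  closure {v | v 0 < 0 ∧ initialIdeal I v = initialIdeal I w}

/-- `C` is an interior Gröbner cone of `I`. -/
def IsInteriorGroebnerCone {R : Type*} [CommRing R] {n : ℕ}
    (I : Ideal (MvPolynomial (Fin n) (PowerSeries R))) (C : Set (Fin (n + 1) → ℝ)) : Prop :=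
  ∃ w : Fin (n + 1) → ℝ, w 0 < 0 ∧ C = groebnerCone I w

/-- `F` is a face of the cone `C`: it is the intersection of `C` with a supporting linear
hyperplane, or `C` itself (the case `l = 0`). -/
def IsFace {m : ℕ} (F C : Set (Fin m → ℝ)) : Prop :=
  ∃ l : (Fin m → ℝ) →ₗ[ℝ] ℝ, (∀ x ∈ C, 0 ≤ l x) ∧ F = {x ∈ C | l x = 0}

end GroebnerFan

/-! Every interior Gröbner cone is polyhedral, cut out by a finite reduced standard basis. Fix $u$
and let $G$ be such a basis of $I$ for the order that compares $u$-degrees first and breaks ties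
lexicographically. For every $w \in C_u(I)$ with $w_0 < 0$, the initial forms
$\operatorname{in}_w(g)$, $g \in G$, still generate $\operatorname{in}_w(I)$. As $G$ is reduced,
$\operatorname{in}_{w'}(I) = \operatorname{in}_w(I)$ if and only if $\operatorname{in}_{w'}(g) =
\operatorname{in}_w(g)$ for all $g \in G$ (`initialIdeal_eq_iff`). Hence $C_w(I)$ consists of the
weights for which the terms of each $\operatorname{in}_w(g)$ are maximal in $g$
(`groebnerCone_eq_initialCone`), and it is a face of $C_u(I)$ (`isFace_initialCone`).

Now take $w$ in $C_u(I) \cap C_v(I)$, with $w_0 < 0$, as if in the relative interior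
(`exists_interior_point`). Then $C_w(I)$ is a face of both cones, so it lies in the intersection.
The functional cutting $C_w(I)$ out of $C_u(I)$ vanishes at $w$, hence on the whole intersection,
which gives the other inclusion.

Two points differ from Gröbner bases over a field. The orders are not well-orders; instead, in each
$\mathbf{x}$-degree only finitely many exponents exceed a given one, and counting them
(`TermOrder.rank`) drives the inductions. Reduction may be infinite, and its limit stays in $I$ by
Krull's intersection theorem (`mem_of_forall_exists_mixedCoeff_eq`). Since $R$ is only a ring,
leading terms are recorded by ideals of coefficients (`leadIdeal`), compared between orders in
`leadIdeal_le_of_common_heads`. -/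

namespace GroebnerFan

/-! ### Coefficients, monomials and homogeneity in `R⟦t⟧[x]` -/

section Coefficients

variable {R : Type*} [CommRing R] {n : ℕ}

@[simp]
theorem mixedCoeff_zero (e : Fin (n + 1) →₀ ℕ) :
    mixedCoeff (0 : MvPolynomial (Fin n) (PowerSeries R)) e = 0 := by
  simp [mixedCoeff]

@[simp]
theorem mixedCoeff_add (f g : MvPolynomial (Fin n) (PowerSeries R)) (e : Fin (n + 1) →₀ ℕ) :
    mixedCoeff (f + g) e = mixedCoeff f e + mixedCoeff g e := by
  simp [mixedCoeff]

@[simp]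
theorem mixedCoeff_sub (f g : MvPolynomial (Fin n) (PowerSeries R)) (e : Fin (n + 1) →₀ ℕ) :
    mixedCoeff (f - g) e = mixedCoeff f e - mixedCoeff g e := by
  simp [mixedCoeff]

theorem mixedCoeff_ext {f g : MvPolynomial (Fin n) (PowerSeries R)}
    (h : ∀ e, mixedCoeff f e = mixedCoeff g e) : f = g := by
  ext α β
  simpa [mixedCoeff] using h (Finsupp.cons β α)

/-- The monomial `r * t ^ (a 0) * x ^ (a 1, …, a n)` of `R⟦t⟧[x₁, …, xₙ]`. -/
noncomputable def mixedMonomial (a : Fin (n + 1) →₀ ℕ) (r : R) :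
    MvPolynomial (Fin n) (PowerSeries R) :=
  MvPolynomial.monomial a.tail (PowerSeries.monomial (a 0) r)

theorem le_iff_tail_le {a e : Fin (n + 1) →₀ ℕ} : a ≤ e ↔ a 0 ≤ e 0 ∧ a.tail ≤ e.tail := by
  simp only [Finsupp.le_def, Finsupp.tail_apply]
  exact Fin.forall_fin_succ

theorem tail_sub (e a : Fin (n + 1) →₀ ℕ) : (e - a).tail = e.tail - a.tail := by
  ext i
  simp [Finsupp.tail_apply]

theorem tail_add (e a : Fin (n + 1) →₀ ℕ) : (e + a).tail = e.tail + a.tail := by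
  ext i
  simp [Finsupp.tail_apply]

theorem tail_single_zero (N : ℕ) : (Finsupp.single (0 : Fin (n + 1)) N).tail = 0 := by
  ext i
  simp [Finsupp.tail_apply]

theorem monomial_eq_C_mul_X_pow (k : ℕ) (r : R) :
    PowerSeries.monomial k r = PowerSeries.C r * PowerSeries.X ^ k := by
  ext m
  simp [PowerSeries.coeff_monomial, PowerSeries.coeff_X_pow]

open scoped Classical in
theorem mixedCoeff_mixedMonomial_mul (a e : Fin (n + 1) →₀ ℕ) (r : R)
    (f : MvPolynomial (Fin n) (PowerSeries R)) :
    mixedCoeff (mixedMonomial a r * f) e = if a ≤ e then r * mixedCoeff f (e - a) else 0 := by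
  rw [mixedCoeff, mixedMonomial, MvPolynomial.coeff_monomial_mul']
  by_cases h : a.tail ≤ e.tail
  · rw [if_pos h, monomial_eq_C_mul_X_pow, mul_assoc, PowerSeries.coeff_C_mul,
      PowerSeries.coeff_X_pow_mul']
    by_cases h0 : a 0 ≤ e 0
    · rw [if_pos h0, if_pos (le_iff_tail_le.2 ⟨h0, h⟩), mixedCoeff, tail_sub]
      simp
    · rw [if_neg h0, if_neg fun h' => h0 (le_iff_tail_le.1 h').1, mul_zero]
  · rw [if_neg h, if_neg fun h' => h (le_iff_tail_le.1 h').2, map_zero]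

theorem mixedMonomial_isHomogeneous (a : Fin (n + 1) →₀ ℕ) (r : R) :
    (mixedMonomial a r).IsHomogeneous a.tail.degree :=
  MvPolynomial.isHomogeneous_monomial _ rfl

theorem degree_tail_of_mixedCoeff_ne_zero {f : MvPolynomial (Fin n) (PowerSeries R)} {d : ℕ}
    (hf : f.IsHomogeneous d) {e : Fin (n + 1) →₀ ℕ} (he : mixedCoeff f e ≠ 0) :
    e.tail.degree = d := by
  rw [← hf (d := e.tail) fun h => he (by simp [mixedCoeff, h]), Finsupp.degree_eq_weight_one]
  rfl

theorem finite_degree_eq (d : ℕ) : {α : Fin n →₀ ℕ | α.degree = d}.Finite :=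
  (Finsupp.finite_of_degree_le d).subset fun _ h => le_of_eq h

theorem finite_degree_tail_eq (d N : ℕ) :
    {e : Fin (n + 1) →₀ ℕ | e.tail.degree = d ∧ e 0 ≤ N}.Finite := by
  refine (((finite_degree_eq d).prod (Set.finite_Iic N)).image
    fun p : (Fin n →₀ ℕ) × ℕ => Finsupp.cons p.2 p.1).subset fun e he => ?_
  exact ⟨(e.tail, e 0), ⟨he.1, he.2⟩, Finsupp.cons_tail _⟩

theorem exists_isHomogeneous_mixedCoeff_eq (d : ℕ) (φ : (Fin (n + 1) →₀ ℕ) → R)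
    (hφ : ∀ e, φ e ≠ 0 → e.tail.degree = d) :
    ∃ f : MvPolynomial (Fin n) (PowerSeries R), f.IsHomogeneous d ∧
      ∀ e, mixedCoeff f e = φ e := by
  classical
  refine ⟨∑ α ∈ (finite_degree_eq d).toFinset,
    MvPolynomial.monomial α (PowerSeries.mk fun β => φ (Finsupp.cons β α)), ?_, fun e => ?_⟩
  · refine MvPolynomial.IsHomogeneous.sum _ _ _ fun α hα => ?_
    exact MvPolynomial.isHomogeneous_monomial _ (by simpa using hα)
  · rw [mixedCoeff, MvPolynomial.coeff_sum]
    simp only [MvPolynomial.coeff_monomial, Finset.sum_ite_eq', Set.Finite.mem_toFinset,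
      Set.mem_ofPred_eq]
    split_ifs with h
    · simp
    · by_contra hne
      exact h (hφ e fun h0 => hne (by simp [h0]))

/-- The homogeneity of `I` enters the proof only through this closure property. -/
theorem homogeneousComponent_mem {I : Ideal (MvPolynomial (Fin n) (PowerSeries R))}
    (hI : IsXHomogeneous I) {f : MvPolynomial (Fin n) (PowerSeries R)} (hf : f ∈ I) (d : ℕ) :
    MvPolynomial.homogeneousComponent d f ∈ I := by
  obtain ⟨S, hS, rfl⟩ := hI
  let _ := MvPolynomial.gradedAlgebra (σ := Fin n) (R := PowerSeries R)
  refine MvPolynomial.homogeneousComponent_mem_of_mem (Ideal.homogeneous_span _ _ ?_) hf d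
  exact fun g hg => hS g hg

theorem mixedCoeff_homogeneousComponent (f : MvPolynomial (Fin n) (PowerSeries R)) (d : ℕ)
    (e : Fin (n + 1) →₀ ℕ) :
    mixedCoeff (MvPolynomial.homogeneousComponent d f) e =
      if e.tail.degree = d then mixedCoeff f e else 0 := by
  rw [mixedCoeff, MvPolynomial.coeff_homogeneousComponent]
  split_ifs <;> simp [mixedCoeff]

end Coefficients

/-! ### `t`-adic closedness of `I` in each degree -/

section Closed

variable {R : Type*} [CommRing R] {n : ℕ}

theorem span_X_le_jacobson : Ideal.span {(PowerSeries.X : PowerSeries R)} ≤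
    Ideal.jacobson ⊥ := by
  rw [Ideal.span_singleton_le_iff_mem, Ideal.mem_jacobson_bot]
  intro y
  simp [PowerSeries.isUnit_iff_constantCoeff]

theorem fg_homogeneousSubmodule (A : Type*) [CommRing A] (d : ℕ) :
    (MvPolynomial.homogeneousSubmodule (Fin n) A d).FG := by
  classical
  refine ⟨(finite_degree_eq d).toFinset.image fun α => MvPolynomial.monomial α 1, ?_⟩
  refine le_antisymm (Submodule.span_le.2 ?_) fun f hf => ?_
  · intro p hp
    simp only [Finset.coe_image, Set.Finite.coe_toFinset, Set.mem_image, Set.mem_ofPred_eq] at hp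
    obtain ⟨α, hα, rfl⟩ := hp
    exact MvPolynomial.isHomogeneous_monomial _ hα
  · rw [f.as_sum]
    refine Submodule.sum_mem _ fun α hα => ?_
    rw [← mul_one (MvPolynomial.coeff α f), ← smul_eq_mul, ← MvPolynomial.smul_monomial]
    refine Submodule.smul_mem _ _ (Submodule.subset_span ?_)
    simp only [Finset.coe_image, Set.Finite.coe_toFinset, Set.mem_image, Set.mem_ofPred_eq]
    refine ⟨α, ?_, rfl⟩
    rw [← hf (MvPolynomial.mem_support_iff.1 hα), Finsupp.degree_eq_weight_one]
    rfl

/-- A homogeneous element that is congruent to homogeneous elements of `I` modulo every power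
of `t` lies in `I`. -/
theorem mem_of_forall_exists_mixedCoeff_eq [IsNoetherianRing R]
    (I : Ideal (MvPolynomial (Fin n) (PowerSeries R))) {d : ℕ}
    {g : MvPolynomial (Fin n) (PowerSeries R)} (hg : g.IsHomogeneous d)
    (h : ∀ N : ℕ, ∃ f ∈ I, f.IsHomogeneous d ∧
      ∀ e : Fin (n + 1) →₀ ℕ, e 0 < N → mixedCoeff f e = mixedCoeff g e) : g ∈ I := by
  set M : Submodule (PowerSeries R) (MvPolynomial (Fin n) (PowerSeries R) ⧸ I) :=
    (MvPolynomial.homogeneousSubmodule (Fin n) (PowerSeries R) d).map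
      ((Ideal.Quotient.mkₐ (PowerSeries R) I).toLinearMap)
  have hfin : Module.Finite (PowerSeries R) M :=
    Module.Finite.iff_fg.2 ((fg_homogeneousSubmodule _ d).map _)
  have hmem : ∀ f : MvPolynomial (Fin n) (PowerSeries R), f.IsHomogeneous d →
      Ideal.Quotient.mk I f ∈ M := fun f hf => ⟨f, hf, rfl⟩
  -- Krull's intersection theorem: the degree `d` part of the quotient is a finite module over the
  -- noetherian ring `R⟦t⟧`, and `t` lies in the Jacobson radical.
  have hK := Ideal.iInf_pow_smul_eq_bot_of_le_jacobson (M := M) _ (span_X_le_jacobson (R := R))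
  have hz : (⟨Ideal.Quotient.mk I g, hmem g hg⟩ : M) = 0 := by
    rw [← Submodule.mem_bot (PowerSeries R), ← hK, Submodule.mem_iInf]
    intro N
    obtain ⟨f, hfI, hfd, hfg⟩ := h N
    -- `q` is `(g - f) / t ^ N`, obtained by shifting coefficients.
    obtain ⟨q, hq, hqc⟩ := exists_isHomogeneous_mixedCoeff_eq d
      (fun e => mixedCoeff (g - f) (e + Finsupp.single 0 N)) fun e he => by
        have := degree_tail_of_mixedCoeff_ne_zero (hg.sub hfd) he
        rw [tail_add, map_add] at this
        simpa [tail_single_zero] using this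
    have hgf : g - f = (PowerSeries.X ^ N : PowerSeries R) • q := by
      refine mixedCoeff_ext fun e => ?_
      have : ((PowerSeries.X ^ N : PowerSeries R) • q) =
          mixedMonomial (Finsupp.single 0 N) 1 * q := by
        rw [MvPolynomial.smul_eq_C_mul, mixedMonomial, MvPolynomial.C_apply, tail_single_zero,
          monomial_eq_C_mul_X_pow]
        simp
      rw [this, mixedCoeff_mixedMonomial_mul, hqc]
      split_ifs with hle
      · rw [tsub_add_cancel_of_le hle, one_mul]
      · have hlt : e 0 < N := by
          by_contra hcon
          exact hle (by simpa using hcon)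
        rw [mixedCoeff_sub, hfg e hlt, sub_self]
    have hsm : (⟨Ideal.Quotient.mk I g, hmem g hg⟩ : M) =
        (PowerSeries.X ^ N : PowerSeries R) • (⟨Ideal.Quotient.mk I q, hmem q hq⟩ : M) := by
      ext1
      have h1 : Ideal.Quotient.mk I g = Ideal.Quotient.mk I (g - f) := by
        rw [map_sub, Ideal.Quotient.eq_zero_iff_mem.2 hfI, sub_zero]
      change Ideal.Quotient.mk I g = _
      rw [h1, hgf]
      rfl
    rw [hsm]
    exact Submodule.smul_mem_smul (Ideal.pow_mem_pow (Ideal.mem_span_singleton_self _) N)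
      Submodule.mem_top
  exact Ideal.Quotient.eq_zero_iff_mem.1 (congrArg Subtype.val hz)

end Closed

/-! ### Local term orders, leading coefficients and reduction -/

section TermOrders

/-- A strict linear order on exponent vectors that is compatible with addition. -/
structure TermOrder (n : ℕ) where
  /-- The strict order relation. -/
  lt : (Fin (n + 1) →₀ ℕ) → (Fin (n + 1) →₀ ℕ) → Prop
  irrefl : ∀ e, ¬ lt e e
  trans : ∀ {a b c}, lt a b → lt b c → lt a c
  total : ∀ a b, lt a b ∨ a = b ∨ lt b a
  add_left : ∀ {a b} c, lt a b → lt (c + a) (c + b)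

variable {R : Type*} [CommRing R] {n : ℕ}

/-- Among the exponents of a fixed `x`-degree, only finitely many are not smaller than a given
one. -/
def TermOrder.IsLocal (T : TermOrder n) : Prop :=
  ∀ (d : ℕ) (e : Fin (n + 1) →₀ ℕ), {e' | e'.tail.degree = d ∧ ¬ T.lt e' e}.Finite

/-- The number of larger exponents of the same `x`-degree. -/
noncomputable def TermOrder.rank (T : TermOrder n) (e : Fin (n + 1) →₀ ℕ) : ℕ :=
  {e' | e'.tail.degree = e.tail.degree ∧ T.lt e e'}.ncard

/-- Larger exponents have smaller rank, so in one degree a leading term is a term of least rank. -/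
theorem TermOrder.IsLocal.rank_lt {T : TermOrder n} (hT : T.IsLocal) {a b : Fin (n + 1) →₀ ℕ}
    (hdeg : a.tail.degree = b.tail.degree) (h : T.lt a b) : T.rank b < T.rank a := by
  refine Set.ncard_lt_ncard ⟨fun e he => ⟨he.1.trans hdeg.symm, T.trans h he.2⟩, fun hsub => ?_⟩
    ((hT a.tail.degree a).subset fun e he => ⟨he.1, fun h' => T.irrefl _ (T.trans he.2 h')⟩)
  exact T.irrefl b (hsub ⟨hdeg.symm, h⟩).2

theorem TermOrder.IsLocal.eq_of_rank_eq {T : TermOrder n} (hT : T.IsLocal)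
    {a b : Fin (n + 1) →₀ ℕ} (hdeg : a.tail.degree = b.tail.degree)
    (h : T.rank a = T.rank b) : a = b := by
  rcases T.total a b with h' | h' | h'
  · exact absurd h (hT.rank_lt hdeg h').ne'
  · exact h'
  · exact absurd h (hT.rank_lt hdeg.symm h').ne

/-- Every exponent occurring in `f` is at most `e`. -/
def TermOrder.Below (T : TermOrder n) (f : MvPolynomial (Fin n) (PowerSeries R))
    (e : Fin (n + 1) →₀ ℕ) : Prop :=
  ∀ e', mixedCoeff f e' ≠ 0 → e' = e ∨ T.lt e' e

variable {T : TermOrder n} {f g : MvPolynomial (Fin n) (PowerSeries R)}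
  {e e' : Fin (n + 1) →₀ ℕ}

theorem TermOrder.Below.zero : T.Below (0 : MvPolynomial (Fin n) (PowerSeries R)) e :=
  fun _ h => absurd (mixedCoeff_zero _) h

theorem TermOrder.Below.add (hf : T.Below f e) (hg : T.Below g e) : T.Below (f + g) e := by
  intro b hb
  by_cases h : mixedCoeff f b = 0
  · exact hg b (by simpa [h] using hb)
  · exact hf b h

theorem TermOrder.Below.sub (hf : T.Below f e) (hg : T.Below g e) : T.Below (f - g) e := by
  intro b hb
  by_cases h : mixedCoeff f b = 0
  · exact hg b (by simpa [h] using hb)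
  · exact hf b h

theorem TermOrder.Below.of_lt (hf : T.Below f e) (h : T.lt e e') : T.Below f e' := by
  intro b hb
  rcases hf b hb with rfl | h'
  · exact Or.inr h
  · exact Or.inr (T.trans h' h)

theorem TermOrder.Below.mixedCoeff_eq_zero (hf : T.Below f e) (h : T.lt e e') :
    mixedCoeff f e' = 0 := by
  by_contra hne
  rcases hf e' hne with rfl | h'
  · exact T.irrefl _ h
  · exact T.irrefl _ (T.trans h h')

theorem TermOrder.Below.mixedMonomial_mul (hf : T.Below f e) (a : Fin (n + 1) →₀ ℕ) (r : R) :
    T.Below (mixedMonomial a r * f) (a + e) := by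
  classical
  intro b hb
  rw [mixedCoeff_mixedMonomial_mul] at hb
  split_ifs at hb with hab
  · obtain ⟨b, rfl⟩ := exists_add_of_le hab
    rw [add_tsub_cancel_left] at hb
    rcases hf b (right_ne_zero_of_mul hb) with rfl | h
    · exact Or.inl rfl
    · exact Or.inr (T.add_left a h)
  · exact absurd rfl hb

/-- A homogeneous element of `I`, all of whose exponents are at most `e`, of the `x`-degree
of `e`. -/
structure IsHeaded (T : TermOrder n) (I : Ideal (MvPolynomial (Fin n) (PowerSeries R)))
    (e : Fin (n + 1) →₀ ℕ) (f : MvPolynomial (Fin n) (PowerSeries R)) : Prop where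
  mem : f ∈ I
  isHomogeneous : f.IsHomogeneous e.tail.degree
  below : T.Below f e

variable {I : Ideal (MvPolynomial (Fin n) (PowerSeries R))}

theorem IsHeaded.zero : IsHeaded T I e 0 :=
  ⟨I.zero_mem, MvPolynomial.isHomogeneous_zero _ _ _, TermOrder.Below.zero⟩

theorem IsHeaded.add (hf : IsHeaded T I e f) (hg : IsHeaded T I e g) : IsHeaded T I e (f + g) :=
  ⟨I.add_mem hf.mem hg.mem, hf.isHomogeneous.add hg.isHomogeneous, hf.below.add hg.below⟩

theorem IsHeaded.sub (hf : IsHeaded T I e f) (hg : IsHeaded T I e g) : IsHeaded T I e (f - g) :=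
  ⟨I.sub_mem hf.mem hg.mem, hf.isHomogeneous.sub hg.isHomogeneous, hf.below.sub hg.below⟩

theorem IsHeaded.mixedMonomial_mul (hf : IsHeaded T I e f) (a : Fin (n + 1) →₀ ℕ) (r : R) :
    IsHeaded T I (a + e) (mixedMonomial a r * f) := by
  refine ⟨I.mul_mem_left _ hf.mem, ?_, hf.below.mixedMonomial_mul a r⟩
  rw [tail_add, map_add]
  exact (mixedMonomial_isHomogeneous a r).mul hf.isHomogeneous

theorem IsHeaded.of_lt (hf : IsHeaded T I e f) (hdeg : e.tail.degree = e'.tail.degree)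
    (h : T.lt e e') : IsHeaded T I e' f :=
  ⟨hf.mem, hdeg ▸ hf.isHomogeneous, hf.below.of_lt h⟩

theorem mixedCoeff_mixedMonomial_mul_add (a e : Fin (n + 1) →₀ ℕ) (r : R)
    (f : MvPolynomial (Fin n) (PowerSeries R)) :
    mixedCoeff (mixedMonomial a r * f) (a + e) = r * mixedCoeff f e := by
  classical
  rw [mixedCoeff_mixedMonomial_mul, if_pos le_self_add, add_tsub_cancel_left]

/-- The ideal of leading coefficients of `I` at the exponent `e`. -/
def leadIdeal (T : TermOrder n) (I : Ideal (MvPolynomial (Fin n) (PowerSeries R)))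
    (e : Fin (n + 1) →₀ ℕ) : Ideal R where
  carrier := {c | ∃ f, IsHeaded T I e f ∧ mixedCoeff f e = c}
  zero_mem' := ⟨0, IsHeaded.zero, mixedCoeff_zero _⟩
  add_mem' := by
    rintro _ _ ⟨f, hf, rfl⟩ ⟨g, hg, rfl⟩
    exact ⟨f + g, hf.add hg, mixedCoeff_add _ _ _⟩
  smul_mem' := by
    rintro r _ ⟨f, hf, rfl⟩
    exact ⟨mixedMonomial 0 r * f, by simpa using hf.mixedMonomial_mul 0 r,
      by simpa using mixedCoeff_mixedMonomial_mul_add 0 e r f⟩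

theorem TermOrder.IsLocal.exists_below (hT : T.IsLocal) {d : ℕ} (hf : f.IsHomogeneous d)
    (hf0 : f ≠ 0) : ∃ e, mixedCoeff f e ≠ 0 ∧ T.Below f e := by
  have hne : {e | mixedCoeff f e ≠ 0}.Nonempty := by
    by_contra h
    rw [Set.not_nonempty_iff_eq_empty, Set.eq_empty_iff_forall_notMem] at h
    exact hf0 (mixedCoeff_ext fun e => by simpa using h e)
  obtain ⟨e, he, hmin⟩ := (measure T.rank).wf.has_min _ hne
  refine ⟨e, he, fun b hb => ?_⟩
  rcases T.total b e with h | h | h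
  · exact Or.inr h
  · exact Or.inl h
  · refine absurd (hT.rank_lt ?_ h) (hmin b hb)
    rw [degree_tail_of_mixedCoeff_ne_zero hf he, degree_tail_of_mixedCoeff_ne_zero hf hb]

/-- Take a `T₂`-headed `f` at `e` and cancel its `T₁`-leading terms by common heads. These terms are
`T₂`-smaller than `e`, so the coefficient at `e` survives until `e` itself becomes `T₁`-leading. -/
theorem leadIdeal_le_of_common_heads {T₁ T₂ : TermOrder n} (hT : T₁.IsLocal)
    (h : ∀ e, ∀ c ∈ leadIdeal T₁ I e, ∃ f, IsHeaded T₁ I e f ∧ IsHeaded T₂ I e f ∧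
      mixedCoeff f e = c) (e : Fin (n + 1) →₀ ℕ) : leadIdeal T₂ I e ≤ leadIdeal T₁ I e := by
  -- All ranks in the support of `f` exceed `rank e - k`. Each cancellation raises the least rank;
  -- at `k = 0` the exponent `e` can no longer occur.
  have key : ∀ (k : ℕ) (f : MvPolynomial (Fin n) (PowerSeries R)), IsHeaded T₂ I e f →
      (∀ b, mixedCoeff f b ≠ 0 → T₁.rank e < k + T₁.rank b) →
      mixedCoeff f e ∈ leadIdeal T₁ I e := by
    intro k
    induction k with
    | zero =>
      intro f _ hk
      by_cases h0 : mixedCoeff f e = 0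
      · rw [h0]
        exact Ideal.zero_mem _
      · exact absurd (hk e h0) (by simp)
    | succ k ih =>
      intro f hf hk
      by_cases h0 : mixedCoeff f e = 0
      · rw [h0]
        exact Ideal.zero_mem _
      have hf0 : f ≠ 0 := by
        rintro rfl
        exact h0 (mixedCoeff_zero _)
      obtain ⟨b, hb, hbelow⟩ := hT.exists_below hf.isHomogeneous hf0
      have hdeg := degree_tail_of_mixedCoeff_ne_zero hf.isHomogeneous hb
      rcases hbelow e h0 with rfl | hlt
      · exact ⟨f, ⟨hf.mem, hf.isHomogeneous, hbelow⟩, rfl⟩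
      have hbe : T₂.lt b e := by
        rcases hf.below b hb with rfl | h'
        · exact absurd hlt (T₁.irrefl _)
        · exact h'
      obtain ⟨p, hp₁, hp₂, hpc⟩ :=
        h b _ ⟨f, ⟨hf.mem, hdeg.symm ▸ hf.isHomogeneous, hbelow⟩, rfl⟩
      have hpe : mixedCoeff p e = 0 := hp₂.below.mixedCoeff_eq_zero hbe
      have := ih (f - p) (hf.sub (hp₂.of_lt hdeg hbe)) fun b' hb' => by
        have hd : b'.tail.degree = e.tail.degree :=
          degree_tail_of_mixedCoeff_ne_zero
            (hf.sub (hp₂.of_lt hdeg hbe)).isHomogeneous hb'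
        rcases hbelow.sub hp₁.below b' hb' with rfl | hlt'
        · exact absurd (by simp [hpc]) hb'
        · have h1 := hT.rank_lt (hd.trans hdeg.symm) hlt'
          have h2 := hk b hb
          omega
      rwa [mixedCoeff_sub, hpe, sub_zero] at this
  rintro c ⟨f, hf, rfl⟩
  exact key (T₁.rank e + 1) f hf fun b _ => by omega

/-- No nonzero term of `g` other than the one at `e` is a leading term of `I`. -/
def IsReducedAt (T : TermOrder n) (I : Ideal (MvPolynomial (Fin n) (PowerSeries R)))
    (e : Fin (n + 1) →₀ ℕ) (g : MvPolynomial (Fin n) (PowerSeries R)) : Prop :=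
  ∀ b, b ≠ e → mixedCoeff g b ∈ leadIdeal T I b → mixedCoeff g b = 0

/-- In a fixed degree at most one exponent has rank `k`. Subtracting an element headed there clears
this term and otherwise alters only terms of larger rank. -/
theorem IsHeaded.exists_reduce_rank (hT : T.IsLocal) (hf : IsHeaded T I e f) (k : ℕ) :
    ∃ g, IsHeaded T I e g ∧ mixedCoeff g e = mixedCoeff f e ∧
      (∀ b, T.rank b < k → mixedCoeff g b = mixedCoeff f b) ∧
      ∀ b, b ≠ e → T.rank b = k → mixedCoeff g b ∈ leadIdeal T I b → mixedCoeff g b = 0 := by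
  by_cases h : ∃ b, b ≠ e ∧ T.rank b = k ∧ mixedCoeff f b ∈ leadIdeal T I b ∧ mixedCoeff f b ≠ 0
  · obtain ⟨b, hbe, hbk, ⟨p, hp, hpc⟩, hb0⟩ := h
    have hlt := (hf.below b hb0).resolve_left hbe
    have hdeg := degree_tail_of_mixedCoeff_ne_zero hf.isHomogeneous hb0
    have hg := hf.sub (hp.of_lt hdeg hlt)
    refine ⟨f - p, hg, ?_, fun b' hb' => ?_, fun b' _ hb' _ => ?_⟩
    · rw [mixedCoeff_sub, hp.below.mixedCoeff_eq_zero hlt, sub_zero]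
    · rw [mixedCoeff_sub, sub_eq_self]
      by_contra hne
      have hd := degree_tail_of_mixedCoeff_ne_zero hp.isHomogeneous hne
      rcases hp.below b' hne with rfl | h'
      · omega
      · have := hT.rank_lt hd h'
        omega
    · by_contra hne
      have hd := degree_tail_of_mixedCoeff_ne_zero hg.isHomogeneous hne
      obtain rfl := hT.eq_of_rank_eq (hd.trans hdeg.symm) (hb'.trans hbk.symm)
      exact hne (by simp [hpc])
  · push Not at h
    exact ⟨f, hf, rfl, fun _ _ => rfl, fun b hbe hbk hb => h b hbe hbk hb⟩

/-- Clearing ranks 0, 1, 2, … in turn fixes each coefficient after finitely many steps, so a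
coefficientwise limit exists; `I` contains it by closedness. -/
theorem IsHeaded.exists_isReducedAt [IsNoetherianRing R] (hT : T.IsLocal)
    (hf : IsHeaded T I e f) :
    ∃ g, IsHeaded T I e g ∧ mixedCoeff g e = mixedCoeff f e ∧ IsReducedAt T I e g := by
  choose! step hstep using fun (k : ℕ) (h : MvPolynomial (Fin n) (PowerSeries R))
    (hh : IsHeaded T I e h) => hh.exists_reduce_rank hT k
  obtain ⟨F, hF0, hFs⟩ : ∃ F : ℕ → MvPolynomial (Fin n) (PowerSeries R),
      F 0 = f ∧ ∀ k, F (k + 1) = step k (F k) :=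
    ⟨fun k => Nat.rec f step k, rfl, fun _ => rfl⟩
  have hF : ∀ k, IsHeaded T I e (F k) := by
    intro k
    induction k with
    | zero => exact hF0 ▸ hf
    | succ k ih => exact hFs k ▸ (hstep k _ ih).1
  have hFe : ∀ k, mixedCoeff (F k) e = mixedCoeff f e := by
    intro k
    induction k with
    | zero => rw [hF0]
    | succ k ih => rw [hFs, (hstep k _ (hF k)).2.1, ih]
  have hstable : ∀ b m, T.rank b + 1 ≤ m →
      mixedCoeff (F m) b = mixedCoeff (F (T.rank b + 1)) b := by
    intro b m hm
    induction m, hm using Nat.le_induction with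
    | base => rfl
    | succ m hm ih => rw [hFs, (hstep m _ (hF m)).2.2.1 b (by omega), ih]
  obtain ⟨g, hg, hgc⟩ := exists_isHomogeneous_mixedCoeff_eq e.tail.degree
    (fun b => mixedCoeff (F (T.rank b + 1)) b)
    fun b hb => degree_tail_of_mixedCoeff_ne_zero (hF (T.rank b + 1)).isHomogeneous hb
  refine ⟨g, ⟨?_, hg, fun b hb => ?_⟩, ?_, fun b hbe hb => ?_⟩
  · refine mem_of_forall_exists_mixedCoeff_eq I hg fun N => ?_
    -- Only finitely many exponents of this degree have `t`-exponent at most `N`. Once all their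
    -- ranks have been treated, the sequence agrees with the limit modulo `t ^ N`.
    obtain ⟨M, hM⟩ := ((finite_degree_tail_eq (n := n) e.tail.degree N).image T.rank).bddAbove
    refine ⟨F (M + 1), (hF _).mem, (hF _).isHomogeneous, fun b hbN => ?_⟩
    by_cases hd : b.tail.degree = e.tail.degree
    · have : T.rank b ≤ M := hM ⟨b, ⟨hd, hbN.le⟩, rfl⟩
      rw [hgc, hstable b _ (by omega)]
    · rw [not_not.1 fun h => hd (degree_tail_of_mixedCoeff_ne_zero (hF _).isHomogeneous h),
        not_not.1 fun h => hd (degree_tail_of_mixedCoeff_ne_zero hg h)]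
  · rw [hgc] at hb
    exact (hF _).below b hb
  · rw [hgc, hFe]
  · rw [hgc, hFs] at hb ⊢
    exact (hstep _ _ (hF _)).2.2.2 b hbe rfl hb

end TermOrders

/-! ### Weight orders with tie-breaking -/

section Refinement

variable {R : Type*} [CommRing R] {n : ℕ}

theorem weightedDegree_add (w : Fin (n + 1) → ℝ) (a b : Fin (n + 1) →₀ ℕ) :
    weightedDegree w (a + b) = weightedDegree w a + weightedDegree w b := by
  simp [weightedDegree, mul_add, Finset.sum_add_distrib]

theorem weightedDegree_add_smul (w u : Fin (n + 1) → ℝ) (c : ℝ) (e : Fin (n + 1) →₀ ℕ) :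
    weightedDegree (w + c • u) e = weightedDegree w e + c * weightedDegree u e := by
  simp [weightedDegree, add_mul, Finset.sum_add_distrib, Finset.mul_sum, mul_assoc]

/-- The `x`-part takes finitely many values, and as `w 0 < 0` a lower bound on the weight bounds the
`t`-exponent. This makes weight orders local. -/
theorem finite_le_weightedDegree {w : Fin (n + 1) → ℝ} (hw : w 0 < 0) (d : ℕ) (γ : ℝ) :
    {e : Fin (n + 1) →₀ ℕ | e.tail.degree = d ∧ γ ≤ weightedDegree w e}.Finite := by
  obtain ⟨B, hB⟩ := ((finite_degree_eq (n := n) d).image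
    fun α => ∑ i, w i.succ * (α i : ℝ)).bddAbove
  refine (finite_degree_tail_eq d ⌈(B - γ) / -w 0⌉₊).subset fun e he => ⟨he.1, ?_⟩
  have h1 : ∑ i, w (Fin.succ i) * (e.tail i : ℝ) ≤ B := hB ⟨e.tail, he.1, rfl⟩
  have h2 : γ ≤ weightedDegree w e := he.2
  simp only [weightedDegree, Fin.sum_univ_succ] at h2
  simp only [Finsupp.tail_apply] at h1
  have h3 : (e 0 : ℝ) ≤ (B - γ) / -w 0 := by
    rw [le_div_iff₀ (by linarith)]
    linarith
  exact_mod_cast h3.trans (Nat.le_ceil _)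

/-- The lexicographic order on exponents. -/
def TermOrder.lex (n : ℕ) : TermOrder n where
  lt a b := toLex a < toLex b
  irrefl _ := lt_irrefl _
  trans := lt_trans
  total a b := by
    rcases lt_trichotomy (toLex a) (toLex b) with h | h | h
    · exact Or.inl h
    · exact Or.inr (Or.inl (toLex.injective h))
    · exact Or.inr (Or.inr h)
  add_left c h := by
    rw [toLex_add, toLex_add]
    exact add_lt_add_right h _

/-- The term order comparing weighted degrees first and breaking ties by `T`. -/
def TermOrder.refine (w : Fin (n + 1) → ℝ) (T : TermOrder n) : TermOrder n where
  lt a b := weightedDegree w a < weightedDegree w b ∨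
    weightedDegree w a = weightedDegree w b ∧ T.lt a b
  irrefl e h := h.elim (lt_irrefl _) fun h => T.irrefl _ h.2
  trans := by
    rintro a b c (h | ⟨h, h'⟩) (k | ⟨k, k'⟩)
    · exact Or.inl (h.trans k)
    · exact Or.inl (h.trans_eq k)
    · exact Or.inl (h.trans_lt k)
    · exact Or.inr ⟨h.trans k, T.trans h' k'⟩
  total a b := by
    rcases lt_trichotomy (weightedDegree w a) (weightedDegree w b) with h | h | h
    · exact Or.inl (Or.inl h)
    · rcases T.total a b with h' | h' | h'
      · exact Or.inl (Or.inr ⟨h, h'⟩)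
      · exact Or.inr (Or.inl h')
      · exact Or.inr (Or.inr (Or.inr ⟨h.symm, h'⟩))
    · exact Or.inr (Or.inr (Or.inl h))
  add_left c h := by
    simp only [weightedDegree_add, add_lt_add_iff_left, add_right_inj]
    exact h.imp_right fun h => ⟨h.1, T.add_left c h.2⟩

theorem TermOrder.isLocal_refine {w : Fin (n + 1) → ℝ} (hw : w 0 < 0) (T : TermOrder n) :
    (T.refine w).IsLocal := fun d e =>
  (finite_le_weightedDegree hw d (weightedDegree w e)).subset fun _ he =>
    ⟨he.1, not_lt.1 fun h => he.2 (Or.inl h)⟩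

theorem TermOrder.Below.weightedDegree_le {w : Fin (n + 1) → ℝ} {T : TermOrder n}
    {f : MvPolynomial (Fin n) (PowerSeries R)} {e b : Fin (n + 1) →₀ ℕ}
    (hf : (T.refine w).Below f e) (hb : mixedCoeff f b ≠ 0) :
    weightedDegree w b ≤ weightedDegree w e := by
  rcases hf b hb with rfl | h | h
  · exact le_rfl
  · exact h.le
  · exact h.1.le

theorem TermOrder.Below.mem_initialSupport {w : Fin (n + 1) → ℝ} {T : TermOrder n}
    {f : MvPolynomial (Fin n) (PowerSeries R)} {e : Fin (n + 1) →₀ ℕ}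
    (hf : (T.refine w).Below f e) (he : mixedCoeff f e ≠ 0) : e ∈ initialSupport w f :=
  ⟨he, fun _ hb => hf.weightedDegree_le hb⟩

theorem TermOrder.Below.refine {w : Fin (n + 1) → ℝ} {T : TermOrder n}
    {f : MvPolynomial (Fin n) (PowerSeries R)} {e : Fin (n + 1) →₀ ℕ}
    (hf : T.Below f e) (he : e ∈ initialSupport w f) : (T.refine w).Below f e := by
  intro b hb
  rcases hf b hb with rfl | h
  · exact Or.inl rfl
  · rcases (he.2 b hb).lt_or_eq with h' | h'
    · exact Or.inr (Or.inl h')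
    · exact Or.inr (Or.inr ⟨h', h⟩)

theorem mem_initialSupport_iff {w : Fin (n + 1) → ℝ}
    {f : MvPolynomial (Fin n) (PowerSeries R)} {e b : Fin (n + 1) →₀ ℕ}
    (he : e ∈ initialSupport w f) : b ∈ initialSupport w f ↔
      mixedCoeff f b ≠ 0 ∧ weightedDegree w b = weightedDegree w e :=
  ⟨fun h => ⟨h.1, le_antisymm (he.2 b h.1) (h.2 e he.1)⟩,
    fun h => ⟨h.1, fun c hc => (he.2 c hc).trans_eq h.2.symm⟩⟩

end Refinement

/-! ### Parts of fixed weight and initial forms -/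

section TopPart

variable {R : Type*} [CommRing R] {n : ℕ} {w : Fin (n + 1) → ℝ}

/-- The sum of the terms of `f` of weighted degree `γ`. -/
noncomputable def topPart (w : Fin (n + 1) → ℝ) (γ : ℝ)
    (f : MvPolynomial (Fin n) (PowerSeries R)) : MvPolynomial (Fin (n + 1)) R :=
  ∑ᶠ e ∈ {e | mixedCoeff f e ≠ 0 ∧ weightedDegree w e = γ},
    MvPolynomial.monomial e (mixedCoeff f e)

theorem finite_topPart_support (hw : w 0 < 0) (γ : ℝ)
    (f : MvPolynomial (Fin n) (PowerSeries R)) :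
    {e | mixedCoeff f e ≠ 0 ∧ weightedDegree w e = γ}.Finite := by
  refine (Set.Finite.biUnion (f.support.finite_toSet)
    fun α _ => finite_le_weightedDegree hw α.degree γ).subset fun e he => ?_
  simp only [Set.mem_iUnion]
  refine ⟨e.tail, ?_, rfl, he.2.ge⟩
  simp only [Finset.mem_coe, MvPolynomial.mem_support_iff]
  intro h0
  exact he.1 (by simp [mixedCoeff, h0])

open scoped Classical in
theorem coeff_topPart (hw : w 0 < 0) (γ : ℝ) (f : MvPolynomial (Fin n) (PowerSeries R))
    (e : Fin (n + 1) →₀ ℕ) : MvPolynomial.coeff e (topPart w γ f) =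
      if weightedDegree w e = γ then mixedCoeff f e else 0 := by
  rw [topPart, finsum_mem_eq_finite_toFinset_sum _ (finite_topPart_support hw γ f),
    MvPolynomial.coeff_sum]
  by_cases h : mixedCoeff f e = 0 <;> simp [MvPolynomial.coeff_monomial, h]

theorem topPart_add (hw : w 0 < 0) (γ : ℝ) (f g : MvPolynomial (Fin n) (PowerSeries R)) :
    topPart w γ (f + g) = topPart w γ f + topPart w γ g := by
  classical
  ext e
  simp only [MvPolynomial.coeff_add, coeff_topPart hw, mixedCoeff_add]
  split_ifs <;> simp

theorem topPart_eq_zero (hw : w 0 < 0) {γ : ℝ} {f : MvPolynomial (Fin n) (PowerSeries R)}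
    (h : ∀ e, mixedCoeff f e ≠ 0 → weightedDegree w e ≠ γ) : topPart w γ f = 0 := by
  classical
  ext e
  rw [coeff_topPart hw, MvPolynomial.coeff_zero, ite_eq_right_iff]
  intro he
  by_contra hne
  exact h e hne he

theorem topPart_mixedMonomial_mul (hw : w 0 < 0) (γ : ℝ) (a : Fin (n + 1) →₀ ℕ) (r : R)
    (f : MvPolynomial (Fin n) (PowerSeries R)) :
    topPart w (weightedDegree w a + γ) (mixedMonomial a r * f) =
      MvPolynomial.monomial a r * topPart w γ f := by
  classical
  ext e
  rw [coeff_topPart hw, mixedCoeff_mixedMonomial_mul, MvPolynomial.coeff_monomial_mul']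
  by_cases hae : a ≤ e
  · obtain ⟨e, rfl⟩ := exists_add_of_le hae
    simp [coeff_topPart hw, weightedDegree_add]
  · simp [hae]

theorem initialForm_eq_topPart (hw : w 0 < 0) {f : MvPolynomial (Fin n) (PowerSeries R)}
    {e : Fin (n + 1) →₀ ℕ} (he : e ∈ initialSupport w f) :
    initialForm w f = topPart w (weightedDegree w e) f := by
  classical
  ext b
  rw [coeff_initialForm hw, coeff_topPart hw]
  by_cases h0 : mixedCoeff f b = 0 <;> simp [mem_initialSupport_iff he, h0]

theorem initialForm_eq_zero {f : MvPolynomial (Fin n) (PowerSeries R)}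
    (h : initialSupport w f = ∅) : initialForm w f = 0 := by
  simp [initialForm, h]

theorem initialForm_congr {w' : Fin (n + 1) → ℝ} {f : MvPolynomial (Fin n) (PowerSeries R)}
    (h : initialSupport w f = initialSupport w' f) : initialForm w f = initialForm w' f := by
  simp only [initialForm, h]

end TopPart

/-! ### Lifting elements of the initial ideal to `I` -/

section InitialIdeal

variable {R : Type*} [CommRing R] {n : ℕ} {w : Fin (n + 1) → ℝ}
  {I : Ideal (MvPolynomial (Fin n) (PowerSeries R))}

/-- Elements of the initial ideal are obtained degree by degree as top parts of elements
of `I`. -/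
theorem exists_mem_mixedCoeff_eq_coeff (hI : IsXHomogeneous I) (hw : w 0 < 0)
    {q : MvPolynomial (Fin (n + 1)) R} (hq : q ∈ initialIdeal I w) (γ : ℝ) (d : ℕ) :
    ∃ f ∈ I, f.IsHomogeneous d ∧ (∀ e, mixedCoeff f e ≠ 0 → weightedDegree w e ≤ γ) ∧
      ∀ e, weightedDegree w e = γ → e.tail.degree = d →
        mixedCoeff f e = MvPolynomial.coeff e q := by
  classical
  induction hq using Submodule.span_induction generalizing γ d with
  | mem q hq =>
    obtain ⟨f, hf, rfl⟩ := hq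
    by_cases h : ∃ b ∈ initialSupport w f, weightedDegree w b = γ
    · obtain ⟨b, hb, rfl⟩ := h
      refine ⟨MvPolynomial.homogeneousComponent d f, homogeneousComponent_mem hI hf d,
        MvPolynomial.homogeneousComponent_isHomogeneous d f, fun e he => ?_, fun e he hed => ?_⟩
      · rw [mixedCoeff_homogeneousComponent] at he
        split_ifs at he with hd
        · exact hb.2 e he
        · exact absurd rfl he
      · rw [mixedCoeff_homogeneousComponent, if_pos hed, initialForm_eq_topPart hw hb,
          coeff_topPart hw, if_pos he]
    · refine ⟨0, I.zero_mem, MvPolynomial.isHomogeneous_zero _ _ _, fun e he => ?_,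
        fun e he hed => ?_⟩
      · exact absurd (mixedCoeff_zero e) he
      · rw [mixedCoeff_zero, coeff_initialForm hw, if_neg fun h' => h ⟨e, h', he⟩]
  | zero =>
    exact ⟨0, I.zero_mem, MvPolynomial.isHomogeneous_zero _ _ _,
      fun e he => absurd (mixedCoeff_zero e) he, fun e _ _ => by simp⟩
  | add p q _ _ hp hq =>
    obtain ⟨f, hf, hfd, hfw, hfc⟩ := hp γ d
    obtain ⟨g, hg, hgd, hgw, hgc⟩ := hq γ d
    refine ⟨f + g, I.add_mem hf hg, hfd.add hgd, fun e he => ?_, fun e he hed => ?_⟩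
    · by_cases h : mixedCoeff f e = 0
      · exact hgw e (by simpa [h] using he)
      · exact hfw e h
    · rw [mixedCoeff_add, hfc e he hed, hgc e he hed, MvPolynomial.coeff_add]
  | smul p q _ hq =>
    -- Multiplication by a monomial shifts both the weight and the degree, so `γ` and `d` must vary.
    induction p using MvPolynomial.induction_on' generalizing γ d with
    | monomial a r =>
      by_cases had : a.tail.degree ≤ d
      · obtain ⟨d, rfl⟩ := exists_add_of_le had
        obtain ⟨f, hf, hfd, hfw, hfc⟩ := hq (γ - weightedDegree w a) d
        refine ⟨mixedMonomial a r * f, I.mul_mem_left _ hf,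
          (mixedMonomial_isHomogeneous a r).mul hfd, fun e he => ?_, fun e he hed => ?_⟩
        · rw [mixedCoeff_mixedMonomial_mul] at he
          split_ifs at he with hae
          · obtain ⟨e, rfl⟩ := exists_add_of_le hae
            rw [add_tsub_cancel_left] at he
            have := hfw e (right_ne_zero_of_mul he)
            rw [weightedDegree_add]
            linarith
          · exact absurd rfl he
        · rw [mixedCoeff_mixedMonomial_mul, smul_eq_mul, MvPolynomial.coeff_monomial_mul']
          split_ifs with hae
          · obtain ⟨e, rfl⟩ := exists_add_of_le hae
            rw [weightedDegree_add] at he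
            rw [tail_add, map_add] at hed
            rw [add_tsub_cancel_left, hfc e (by linarith) (by omega)]
          · rfl
      · refine ⟨0, I.zero_mem, MvPolynomial.isHomogeneous_zero _ _ _, fun e he => ?_,
          fun e he hed => ?_⟩
        · exact absurd (mixedCoeff_zero e) he
        · rw [smul_eq_mul, MvPolynomial.coeff_monomial_mul', if_neg fun hae => ?_,
            mixedCoeff_zero]
          obtain ⟨e, rfl⟩ := exists_add_of_le hae
          rw [tail_add, map_add] at hed
          omega
    | add p p' hp hp' =>
      obtain ⟨f, hf, hfd, hfw, hfc⟩ := hp γ d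
      obtain ⟨g, hg, hgd, hgw, hgc⟩ := hp' γ d
      refine ⟨f + g, I.add_mem hf hg, hfd.add hgd, fun e he => ?_, fun e he hed => ?_⟩
      · by_cases h : mixedCoeff f e = 0
        · exact hgw e (by simpa [h] using he)
        · exact hfw e h
      · rw [mixedCoeff_add, hfc e he hed, hgc e he hed, add_smul, MvPolynomial.coeff_add]

/-- For `q` in the initial ideal, the leading coefficient of `q` is a leading coefficient
of `I`. -/
theorem coeff_mem_leadIdeal (hI : IsXHomogeneous I) (hw : w 0 < 0) (T : TermOrder n)
    {q : MvPolynomial (Fin (n + 1)) R} (hq : q ∈ initialIdeal I w) {b : Fin (n + 1) →₀ ℕ}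
    (hb : ∀ e, e.tail.degree = b.tail.degree → MvPolynomial.coeff e q ≠ 0 →
      e = b ∨ (T.refine w).lt e b) :
    MvPolynomial.coeff b q ∈ leadIdeal (T.refine w) I b := by
  obtain ⟨f, hf, hfd, hfw, hfc⟩ :=
    exists_mem_mixedCoeff_eq_coeff hI hw hq (weightedDegree w b) b.tail.degree
  refine ⟨f, ⟨hf, hfd, fun e he => ?_⟩, hfc b rfl rfl⟩
  rcases (hfw e he).lt_or_eq with h | h
  · exact Or.inr (Or.inl h)
  · have hd := degree_tail_of_mixedCoeff_ne_zero hfd he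
    exact hb e hd (hfc e h hd ▸ he)

end InitialIdeal

/-! ### Reduced standard bases -/

section ReducedBasis

variable {R : Type*} [CommRing R] {n : ℕ} {w : Fin (n + 1) → ℝ}
  {I : Ideal (MvPolynomial (Fin n) (PowerSeries R))}

/-- A finite set of elements of `I`, each with a marked exponent, that form a reduced standard
basis of `I` for the term order `T`. -/
structure IsReducedBasis (T : TermOrder n) (I : Ideal (MvPolynomial (Fin n) (PowerSeries R)))
    (G : Set ((Fin (n + 1) →₀ ℕ) × MvPolynomial (Fin n) (PowerSeries R))) : Prop where
  finite : G.Finite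
  isHeaded : ∀ p ∈ G, IsHeaded T I p.1 p.2
  mixedCoeff_ne_zero : ∀ p ∈ G, mixedCoeff p.2 p.1 ≠ 0
  isReducedAt : ∀ p ∈ G, IsReducedAt T I p.1 p.2
  leadIdeal_le : ∀ e, leadIdeal T I e ≤
    Ideal.span {c | ∃ p ∈ G, p.1 ≤ e ∧ mixedCoeff p.2 p.1 = c}

/-- The ideal of leading terms in the noetherian ring `R[t, x]` is generated by finitely many of
them. Lifting each to `I` and reducing it keeps its leading term. -/
theorem exists_isReducedBasis [IsNoetherianRing R] {T : TermOrder n} (hT : T.IsLocal)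
    (I : Ideal (MvPolynomial (Fin n) (PowerSeries R))) : ∃ G, IsReducedBasis T I G := by
  classical
  let B : Set (MvPolynomial (Fin (n + 1)) R) :=
    {q | ∃ e, ∃ c ∈ leadIdeal T I e, c ≠ 0 ∧ q = MvPolynomial.monomial e c}
  obtain ⟨s, hsB, hs⟩ := (Submodule.fg_span_iff_fg_span_finset_subset B).1
    (IsNoetherian.noetherian (Submodule.span (MvPolynomial (Fin (n + 1)) R) B))
  have hex : ∀ q ∈ s, ∃ p : (Fin (n + 1) →₀ ℕ) × MvPolynomial (Fin n) (PowerSeries R),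
      IsHeaded T I p.1 p.2 ∧ mixedCoeff p.2 p.1 ≠ 0 ∧ IsReducedAt T I p.1 p.2 ∧
        q = MvPolynomial.monomial p.1 (mixedCoeff p.2 p.1) := by
    intro q hq
    obtain ⟨e, c, ⟨f, hf, rfl⟩, hc0, rfl⟩ := hsB hq
    obtain ⟨g, hg, hgc, hgr⟩ := hf.exists_isReducedAt hT
    exact ⟨(e, g), hg, hgc ▸ hc0, hgr, by rw [hgc]⟩
  choose! p hp using hex
  refine ⟨p '' s, s.finite_toSet.image p, ?_, ?_, ?_, fun e c hc => ?_⟩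
  · rintro _ ⟨q, hq, rfl⟩
    exact (hp q hq).1
  · rintro _ ⟨q, hq, rfl⟩
    exact (hp q hq).2.1
  · rintro _ ⟨q, hq, rfl⟩
    exact (hp q hq).2.2.1
  · by_cases hc0 : c = 0
    · rw [hc0]
      exact Ideal.zero_mem _
    set K : (Fin (n + 1) →₀ ℕ) → Ideal R := fun e =>
      Ideal.span {c | ∃ r ∈ p '' (s : Set _), r.1 ≤ e ∧ mixedCoeff r.2 r.1 = c}
    have hmono : ∀ a b, a ≤ b → K a ≤ K b := fun a b hab => Ideal.span_mono <| by
      rintro _ ⟨r, hr, hra, rfl⟩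
      exact ⟨r, hr, hra.trans hab, rfl⟩
    have key : ∀ q ∈ Submodule.span (MvPolynomial (Fin (n + 1)) R)
        (s : Set (MvPolynomial (Fin (n + 1)) R)), ∀ e, MvPolynomial.coeff e q ∈ K e := by
      intro q hq
      induction hq using Submodule.span_induction with
      | mem q hq =>
        intro e
        rw [(hp q hq).2.2.2, MvPolynomial.coeff_monomial]
        split_ifs with h
        · exact Ideal.subset_span ⟨p q, ⟨q, hq, rfl⟩, h.le, rfl⟩
        · exact Ideal.zero_mem _
      | zero => exact fun e => by simp
      | add q q' _ _ h h' =>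
        intro e
        rw [MvPolynomial.coeff_add]
        exact Ideal.add_mem _ (h e) (h' e)
      | smul r q _ h =>
        intro e
        rw [smul_eq_mul, MvPolynomial.coeff_mul]
        refine Ideal.sum_mem _ fun x hx => Ideal.mul_mem_left _ _ (hmono _ _ ?_ (h x.2))
        rw [← Finset.HasAntidiagonal.mem_antidiagonal.1 hx]
        exact le_add_self
    have := key (MvPolynomial.monomial e c)
      (hs ▸ Submodule.subset_span ⟨e, c, hc, hc0, rfl⟩) e
    rwa [MvPolynomial.coeff_monomial, if_pos rfl] at this

/-- A combination of multiples of the elements of `G` with prescribed coefficient at `e`. -/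
theorem exists_combination
    {G : Set ((Fin (n + 1) →₀ ℕ) × MvPolynomial (Fin n) (PowerSeries R))}
    {e : Fin (n + 1) →₀ ℕ} {c : R}
    (hc : c ∈ Ideal.span {c | ∃ p ∈ G, p.1 ≤ e ∧ mixedCoeff p.2 p.1 = c}) :
    ∃ f, mixedCoeff f e = c ∧
      (∀ T : TermOrder n, (∀ p ∈ G, IsHeaded T I p.1 p.2) → IsHeaded T I e f) ∧
      ∀ w : Fin (n + 1) → ℝ, w 0 < 0 → (∀ p ∈ G, p.1 ∈ initialSupport w p.2) →
        topPart w (weightedDegree w e) f ∈ Ideal.span ((fun p => initialForm w p.2) '' G) := by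
  induction hc using Submodule.span_induction with
  | mem c hc =>
    obtain ⟨p, hp, hpe, rfl⟩ := hc
    obtain ⟨a, rfl⟩ := exists_add_of_le hpe
    rw [add_comm p.1 a]
    refine ⟨mixedMonomial a 1 * p.2, by rw [mixedCoeff_mixedMonomial_mul_add, one_mul],
      fun T hT => (hT p hp).mixedMonomial_mul a 1, fun w hw hG => ?_⟩
    rw [weightedDegree_add, topPart_mixedMonomial_mul hw,
      ← initialForm_eq_topPart hw (hG p hp)]
    exact Ideal.mul_mem_left _ _ (Ideal.subset_span ⟨p, hp, rfl⟩)
  | zero =>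
    refine ⟨0, mixedCoeff_zero e, fun _ _ => IsHeaded.zero, fun w hw _ => ?_⟩
    rw [topPart_eq_zero hw fun b hb => absurd (mixedCoeff_zero b) hb]
    exact Ideal.zero_mem _
  | add c c' _ _ h h' =>
    obtain ⟨f, rfl, hfT, hfw⟩ := h
    obtain ⟨g, rfl, hgT, hgw⟩ := h'
    refine ⟨f + g, mixedCoeff_add _ _ _, fun T hT => (hfT T hT).add (hgT T hT),
      fun w hw hG => ?_⟩
    rw [topPart_add hw]
    exact Ideal.add_mem _ (hfw w hw hG) (hgw w hw hG)
  | smul r c _ h =>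
    obtain ⟨f, rfl, hfT, hfw⟩ := h
    refine ⟨mixedMonomial 0 r * f, ?_, fun T hT => ?_, fun w hw hG => ?_⟩
    · simpa using mixedCoeff_mixedMonomial_mul_add 0 e r f
    · simpa using (hfT T hT).mixedMonomial_mul 0 r
    · have := topPart_mixedMonomial_mul hw (weightedDegree w e) 0 r f
      rw [← weightedDegree_add, zero_add] at this
      rw [this]
      exact Ideal.mul_mem_left _ _ (hfw w hw hG)

theorem IsReducedBasis.leadIdeal_le_leadIdeal {T₁ T₂ : TermOrder n} (hT : T₁.IsLocal)
    {G : Set ((Fin (n + 1) →₀ ℕ) × MvPolynomial (Fin n) (PowerSeries R))}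
    (hG : IsReducedBasis T₁ I G) (hT₂ : ∀ p ∈ G, IsHeaded T₂ I p.1 p.2)
    (e : Fin (n + 1) →₀ ℕ) : leadIdeal T₂ I e ≤ leadIdeal T₁ I e := by
  refine leadIdeal_le_of_common_heads hT (fun e c hc => ?_) e
  obtain ⟨f, hfc, hfT, -⟩ := exists_combination (I := I) (hG.leadIdeal_le e hc)
  exact ⟨f, hfT _ hG.isHeaded, hfT _ hT₂, hfc⟩

theorem initialIdeal_le_span (hI : IsXHomogeneous I) (hw : w 0 < 0) {T : TermOrder n}
    {G : Set ((Fin (n + 1) →₀ ℕ) × MvPolynomial (Fin n) (PowerSeries R))}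
    (hG : ∀ p ∈ G, IsHeaded (T.refine w) I p.1 p.2) (hG0 : ∀ p ∈ G, mixedCoeff p.2 p.1 ≠ 0)
    (hlead : ∀ e, leadIdeal (T.refine w) I e ≤
      Ideal.span {c | ∃ p ∈ G, p.1 ≤ e ∧ mixedCoeff p.2 p.1 = c}) :
    initialIdeal I w ≤ Ideal.span ((fun p => initialForm w p.2) '' G) := by
  set J := Ideal.span ((fun p => initialForm w p.2) '' G)
  have hloc := T.isLocal_refine hw
  have hsupp : ∀ p ∈ G, p.1 ∈ initialSupport w p.2 := fun p hp =>
    (hG p hp).below.mem_initialSupport (hG0 p hp)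
  -- Division in degree `d`, tracking only weight `γ`. All exponents of that weight have rank below
  -- `M`, and each step raises the least rank in the support; once it reaches `M`, no term of weight
  -- `γ` remains.
  have key : ∀ (γ : ℝ) (d M : ℕ),
      (∀ b : Fin (n + 1) →₀ ℕ, b.tail.degree = d → weightedDegree w b = γ →
        (T.refine w).rank b < M) →
      ∀ (k : ℕ) (f : MvPolynomial (Fin n) (PowerSeries R)), f ∈ I → f.IsHomogeneous d →
      (∀ b, mixedCoeff f b ≠ 0 → weightedDegree w b ≤ γ) →
      (∀ b, mixedCoeff f b ≠ 0 → M ≤ k + (T.refine w).rank b) → topPart w γ f ∈ J := by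
    intro γ d M hM k
    induction k with
    | zero =>
      intro f hf hfd hfw hk
      rw [topPart_eq_zero hw fun b hb hbγ => ?_]
      · exact Ideal.zero_mem _
      · have h1 := hM b (degree_tail_of_mixedCoeff_ne_zero hfd hb) hbγ
        have h2 := hk b hb
        omega
    | succ k ih =>
      intro f hf hfd hfw hk
      by_cases h0 : ∀ b, mixedCoeff f b ≠ 0 → weightedDegree w b ≠ γ
      · rw [topPart_eq_zero hw h0]
        exact Ideal.zero_mem _
      push Not at h0
      obtain ⟨b', hb', hbγ'⟩ := h0
      have hf0 : f ≠ 0 := by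
        rintro rfl
        exact hb' (mixedCoeff_zero _)
      obtain ⟨b, hb, hbelow⟩ := hloc.exists_below hfd hf0
      have hbγ : weightedDegree w b = γ :=
        le_antisymm (hfw b hb) (hbγ' ▸ hbelow.weightedDegree_le hb')
      have hdeg := degree_tail_of_mixedCoeff_ne_zero hfd hb
      obtain ⟨g, hgc, hgT, hgw⟩ := exists_combination (I := I)
        (hlead b ⟨f, ⟨hf, hdeg.symm ▸ hfd, hbelow⟩, rfl⟩)
      have hgh := hgT _ hG
      have hsub : topPart w γ (f - g) ∈ J := by
        have hd := hfd.sub (hdeg ▸ hgh.isHomogeneous)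
        refine ih (f - g) (I.sub_mem hf hgh.mem) hd
          (fun c hc => hbγ ▸ (hbelow.sub hgh.below).weightedDegree_le hc) fun c hc => ?_
        rcases hbelow.sub hgh.below c hc with rfl | hlt
        · exact absurd (by simp [hgc]) hc
        · have h1 := hloc.rank_lt
            ((degree_tail_of_mixedCoeff_ne_zero hd hc).trans hdeg.symm) hlt
          have h2 := hk b hb
          omega
      rw [← sub_add_cancel f g, topPart_add hw]
      refine Ideal.add_mem _ hsub ?_
      rw [← hbγ]
      exact hgw w hw hsupp
  refine Ideal.span_le.2 ?_
  rintro _ ⟨f, hf, rfl⟩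
  rcases (initialSupport w f).eq_empty_or_nonempty with hem | ⟨e, he⟩
  · rw [initialForm_eq_zero hem]
    exact Ideal.zero_mem _
  · rw [initialForm_eq_topPart hw he]
    nth_rw 1 [← MvPolynomial.sum_homogeneousComponent f]
    refine Finset.sum_induction _ (fun h => topPart w (weightedDegree w e) h ∈ J)
      (fun a b ha hb => ?_) ?_ fun d _ => ?_
    · rw [topPart_add hw]
      exact Ideal.add_mem _ ha hb
    · rw [topPart_eq_zero hw fun b hb => absurd (mixedCoeff_zero b) hb]
      exact Ideal.zero_mem _
    · obtain ⟨M, hM⟩ := ((finite_le_weightedDegree hw d (weightedDegree w e)).image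
        (T.refine w).rank).bddAbove
      refine key _ d (M + 1) (fun b hbd hbw => Nat.lt_succ_of_le (hM ⟨b, ⟨hbd, hbw.ge⟩, rfl⟩))
        (M + 1) _ (homogeneousComponent_mem hI hf d)
        (MvPolynomial.homogeneousComponent_isHomogeneous d f) (fun b hb => ?_)
        fun b _ => by omega
      rw [mixedCoeff_homogeneousComponent] at hb
      split_ifs at hb with hbd
      · exact he.2 b hb
      · exact absurd rfl hb

end ReducedBasis

/-! ### Gröbner cones as polyhedral cones, and their faces -/

section Cones

variable {R : Type*} [CommRing R] {n : ℕ} {u w : Fin (n + 1) → ℝ}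
  {I : Ideal (MvPolynomial (Fin n) (PowerSeries R))}
  {G : Set ((Fin (n + 1) →₀ ℕ) × MvPolynomial (Fin n) (PowerSeries R))}

theorem initialSupport_nonempty (hw : w 0 < 0) {f : MvPolynomial (Fin n) (PowerSeries R)}
    {d : ℕ} (hf : f.IsHomogeneous d) (hf0 : f ≠ 0) : (initialSupport w f).Nonempty := by
  obtain ⟨e, he, hbelow⟩ := ((TermOrder.lex n).isLocal_refine hw).exists_below hf hf0
  exact ⟨e, hbelow.mem_initialSupport he⟩

theorem mem_initialSupport_iff_coeff_ne_zero (hw : w 0 < 0)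
    {f : MvPolynomial (Fin n) (PowerSeries R)} {e : Fin (n + 1) →₀ ℕ} :
    e ∈ initialSupport w f ↔ MvPolynomial.coeff e (initialForm w f) ≠ 0 := by
  classical
  rw [coeff_initialForm hw]
  split_ifs with h
  · exact ⟨fun h => h.1, fun _ => h⟩
  · simp [h]

theorem initialForm_mem_initialIdeal {f : MvPolynomial (Fin n) (PowerSeries R)} (hf : f ∈ I) :
    initialForm w f ∈ initialIdeal I w :=
  Ideal.subset_span ⟨f, hf, rfl⟩

/-- The basis may come from another order `T₁`: marked terms that are also leading for the `w`-order
suffice, since then the leading ideals of the latter are no larger. -/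
theorem initialIdeal_eq_span (hI : IsXHomogeneous I) (hw : w 0 < 0) {T₁ T : TermOrder n}
    (hT₁ : T₁.IsLocal) (hG : IsReducedBasis T₁ I G)
    (hhead : ∀ p ∈ G, IsHeaded (T.refine w) I p.1 p.2) :
    initialIdeal I w = Ideal.span ((fun p => initialForm w p.2) '' G) := by
  refine le_antisymm (initialIdeal_le_span hI hw hhead hG.mixedCoeff_ne_zero fun e =>
    (hG.leadIdeal_le_leadIdeal hT₁ hhead e).trans (hG.leadIdeal_le e)) (Ideal.span_le.2 ?_)
  rintro _ ⟨p, hp, rfl⟩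
  exact initialForm_mem_initialIdeal (hhead p hp).mem

/-- An element of the initial ideal that is made of terms of a member of a reduced basis
involves the marked term. -/
theorem coeff_marked_ne_zero (hI : IsXHomogeneous I) (hw : w 0 < 0) {T₁ T : TermOrder n}
    (hT₁ : T₁.IsLocal) (hG : IsReducedBasis T₁ I G)
    (hhead : ∀ p ∈ G, IsHeaded (T.refine w) I p.1 p.2)
    {p : (Fin (n + 1) →₀ ℕ) × MvPolynomial (Fin n) (PowerSeries R)} (hp : p ∈ G)
    {q : MvPolynomial (Fin (n + 1)) R} (hq : q ∈ initialIdeal I w) (hq0 : q ≠ 0)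
    (hqp : ∀ b, MvPolynomial.coeff b q ≠ 0 →
      mixedCoeff p.2 b = MvPolynomial.coeff b q ∨ mixedCoeff p.2 b = -MvPolynomial.coeff b q) :
    MvPolynomial.coeff p.1 q ≠ 0 := by
  have hcoef : ∀ b, MvPolynomial.coeff b q ≠ 0 → mixedCoeff p.2 b ≠ 0 := by
    intro b hb
    rcases hqp b hb with h | h <;> rw [h]
    · exact hb
    · exact neg_ne_zero.2 hb
  have hdeg : ∀ b, MvPolynomial.coeff b q ≠ 0 → b.tail.degree = p.1.tail.degree :=
    fun b hb => degree_tail_of_mixedCoeff_ne_zero (hhead p hp).isHomogeneous (hcoef b hb)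
  -- `b` is the leading exponent of `q`. Its coefficient is a leading coefficient of `I`, which
  -- reducedness allows only at the marked exponent.
  obtain ⟨b, hb, hmin⟩ := (measure (T.refine w).rank).wf.has_min
    {b | MvPolynomial.coeff b q ≠ 0} (MvPolynomial.ne_zero_iff.1 hq0)
  have hmem := coeff_mem_leadIdeal hI hw T hq (b := b) fun e _ he => by
    rcases (T.refine w).total e b with h | h | h
    · exact Or.inr h
    · exact Or.inl h
    · exact absurd ((T.isLocal_refine hw).rank_lt ((hdeg b hb).trans (hdeg e he).symm) h)
        (hmin e he)
  have hmem' := hG.leadIdeal_le_leadIdeal hT₁ hhead b hmem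
  by_cases hbp : b = p.1
  · exact hbp ▸ hb
  · refine absurd (hG.isReducedAt p hp b hbp ?_) (hcoef b hb)
    rcases hqp b hb with h | h <;> rw [h]
    · exact hmem'
    · exact neg_mem hmem'

/-- The cone of weights for which the terms of `initialForm w p.2` are maximal in `p.2`, for
all `p ∈ G`. -/
def initialCone (G : Set ((Fin (n + 1) →₀ ℕ) × MvPolynomial (Fin n) (PowerSeries R)))
    (w : Fin (n + 1) → ℝ) : Set (Fin (n + 1) → ℝ) :=
  {x | x 0 ≤ 0 ∧ ∀ p ∈ G, ∀ a ∈ initialSupport w p.2, ∀ b, mixedCoeff p.2 b ≠ 0 →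
    weightedDegree x b ≤ weightedDegree x a}

theorem mem_initialSupport_of_mem_initialCone (hw : w ∈ initialCone G u)
    {p : (Fin (n + 1) →₀ ℕ) × MvPolynomial (Fin n) (PowerSeries R)} (hp : p ∈ G)
    {a : Fin (n + 1) →₀ ℕ} (ha : a ∈ initialSupport u p.2) : a ∈ initialSupport w p.2 :=
  ⟨ha.1, fun b hb => hw.2 p hp a ha b hb⟩

theorem self_mem_initialCone (hw : w 0 < 0) : w ∈ initialCone G w :=
  ⟨hw.le, fun _ _ _ ha b hb => ha.2 b hb⟩

theorem initialCone_add {x y : Fin (n + 1) → ℝ} (hx : x ∈ initialCone G w)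
    (hy : y ∈ initialCone G w) : x + y ∈ initialCone G w := by
  refine ⟨add_nonpos hx.1 hy.1, fun p hp a ha b hb => ?_⟩
  have h := add_le_add (hx.2 p hp a ha b hb) (hy.2 p hp a ha b hb)
  have h' := fun e => weightedDegree_add_smul x y 1 e
  simp only [one_smul, one_mul] at h'
  rwa [h', h']

theorem initialIdeal_eq_iff (hI : IsXHomogeneous I) (hu : u 0 < 0) (hw : w 0 < 0)
    {T : TermOrder n} (hG : IsReducedBasis (T.refine u) I G) (hwu : w ∈ initialCone G u)
    {w' : Fin (n + 1) → ℝ} (hw' : w' 0 < 0) :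
    initialIdeal I w' = initialIdeal I w ↔
      ∀ p ∈ G, initialSupport w' p.2 = initialSupport w p.2 := by
  classical
  have hmark : ∀ p ∈ G, p.1 ∈ initialSupport w p.2 := fun p hp =>
    mem_initialSupport_of_mem_initialCone hwu hp
      ((hG.isHeaded p hp).below.mem_initialSupport (hG.mixedCoeff_ne_zero p hp))
  have hhead : ∀ p ∈ G, IsHeaded ((T.refine u).refine w) I p.1 p.2 := fun p hp =>
    ⟨(hG.isHeaded p hp).mem, (hG.isHeaded p hp).isHomogeneous,
      (hG.isHeaded p hp).below.refine (hmark p hp)⟩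
  have hloc := T.isLocal_refine hu
  constructor
  · intro h p hp
    have hp0 : p.2 ≠ 0 := fun h0 => hG.mixedCoeff_ne_zero p hp (by rw [h0, mixedCoeff_zero])
    have hmem' : initialForm w' p.2 ∈ initialIdeal I w :=
      h ▸ initialForm_mem_initialIdeal (hG.isHeaded p hp).mem
    have hmem : initialForm w p.2 ∈ initialIdeal I w :=
      initialForm_mem_initialIdeal (hG.isHeaded p hp).mem
    -- The `w'`-initial form is a nonzero part of `p.2` lying in the `w`-initial ideal.
    have hmark' : p.1 ∈ initialSupport w' p.2 := by
      rw [mem_initialSupport_iff_coeff_ne_zero hw']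
      refine coeff_marked_ne_zero hI hw hloc hG hhead hp hmem' ?_ fun b hb => ?_
      · obtain ⟨e, he⟩ := initialSupport_nonempty hw' (hG.isHeaded p hp).isHomogeneous hp0
        rw [mem_initialSupport_iff_coeff_ne_zero hw'] at he
        rintro h0
        exact he (by rw [h0, MvPolynomial.coeff_zero])
      · rw [coeff_initialForm hw'] at hb ⊢
        split_ifs at hb ⊢ with hbs
        · exact Or.inl rfl
        · exact absurd rfl hb
    -- Up to sign the difference also consists of terms of `p.2`, but the marked term has cancelled,
    -- so it must vanish.
    have hsub : initialForm w' p.2 - initialForm w p.2 = 0 := by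
      by_contra hne
      refine coeff_marked_ne_zero hI hw hloc hG hhead hp (Ideal.sub_mem _ hmem' hmem) hne
        (fun b hb => ?_) ?_
      · rw [MvPolynomial.coeff_sub, coeff_initialForm hw', coeff_initialForm hw] at hb ⊢
        split_ifs at hb ⊢ <;> simp_all
      · rw [MvPolynomial.coeff_sub, coeff_initialForm hw', coeff_initialForm hw,
          if_pos hmark', if_pos (hmark p hp), sub_self]
    ext b
    rw [mem_initialSupport_iff_coeff_ne_zero hw', mem_initialSupport_iff_coeff_ne_zero hw,
      sub_eq_zero.1 hsub]
  · intro h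
    have hhead' : ∀ p ∈ G, IsHeaded ((T.refine u).refine w') I p.1 p.2 := fun p hp =>
      ⟨(hG.isHeaded p hp).mem, (hG.isHeaded p hp).isHomogeneous,
        (hG.isHeaded p hp).below.refine (h p hp ▸ hmark p hp)⟩
    rw [initialIdeal_eq_span hI hw' hloc hG hhead', initialIdeal_eq_span hI hw hloc hG hhead]
    congr 1
    exact Set.image_congr fun p hp => initialForm_congr (h p hp)

theorem continuous_weightedDegree (e : Fin (n + 1) →₀ ℕ) :
    Continuous fun x : Fin (n + 1) → ℝ => weightedDegree x e := by
  unfold weightedDegree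
  fun_prop

theorem isClosed_initialCone : IsClosed (initialCone G w) := by
  simp only [initialCone, Set.ofPred_and, Set.ofPred_forall]
  refine (isClosed_le (continuous_apply 0) continuous_const).inter ?_
  refine isClosed_iInter fun p => isClosed_iInter fun _ => isClosed_iInter fun a =>
    isClosed_iInter fun _ => isClosed_iInter fun b => isClosed_iInter fun _ => ?_
  exact isClosed_le (continuous_weightedDegree b) (continuous_weightedDegree a)

theorem closure_initialSupport_eq (hw : w 0 < 0)
    (hne : ∀ p ∈ G, (initialSupport w p.2).Nonempty) :
    closure {x : Fin (n + 1) → ℝ | x 0 < 0 ∧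
      ∀ p ∈ G, initialSupport x p.2 = initialSupport w p.2} = initialCone G w := by
  refine Set.Subset.antisymm (closure_minimal (fun x hx => ?_) isClosed_initialCone)
    fun x hx => ?_
  · refine ⟨hx.1.le, fun p hp a ha b hb => ?_⟩
    rw [← hx.2 p hp] at ha
    exact ha.2 b hb
  -- Approach `x` along `x + ε • w`: for `ε > 0` the summand `ε • w` breaks the ties left by `x` so
  -- that exactly the `w`-initial terms remain maximal.
  · have hlim : Filter.Tendsto (fun ε : ℝ => x + ε • w) (nhdsWithin 0 (Set.Ioi 0)) (nhds x) := by
      have : Continuous fun ε : ℝ => x + ε • w := by fun_prop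
      simpa using (this.tendsto 0).mono_left nhdsWithin_le_nhds
    refine mem_closure_of_tendsto hlim (Filter.eventually_of_mem self_mem_nhdsWithin ?_)
    intro ε hε
    have hε : 0 < ε := hε
    refine ⟨?_, fun p hp => ?_⟩
    · have := mul_neg_of_pos_of_neg hε hw
      have h0 := hx.1
      simp only [Pi.add_apply, Pi.smul_apply, smul_eq_mul]
      linarith
    · obtain ⟨a, ha⟩ := hne p hp
      have hmem : ∀ a ∈ initialSupport w p.2, a ∈ initialSupport (x + ε • w) p.2 := by
        refine fun a ha => ⟨ha.1, fun b hb => ?_⟩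
        rw [weightedDegree_add_smul, weightedDegree_add_smul]
        exact add_le_add (hx.2 p hp a ha b hb) (mul_le_mul_of_nonneg_left (ha.2 b hb) hε.le)
      refine Set.Subset.antisymm (fun b hb => ?_) hmem
      obtain ⟨hb0, hbw⟩ := (mem_initialSupport_iff (hmem a ha)).1 hb
      rw [weightedDegree_add_smul, weightedDegree_add_smul] at hbw
      refine (mem_initialSupport_iff ha).2 ⟨hb0, le_antisymm (ha.2 b hb0) ?_⟩
      have := hx.2 p hp a ha b hb0
      by_contra hlt
      have := mul_lt_mul_of_pos_left (not_le.1 hlt) hε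
      linarith

theorem groebnerCone_eq_initialCone (hI : IsXHomogeneous I) (hu : u 0 < 0) (hw : w 0 < 0)
    {T : TermOrder n} (hG : IsReducedBasis (T.refine u) I G) (hwu : w ∈ initialCone G u) :
    groebnerCone I w = initialCone G w := by
  rw [← closure_initialSupport_eq hw fun p hp => initialSupport_nonempty hw
    (hG.isHeaded p hp).isHomogeneous fun h0 =>
      hG.mixedCoeff_ne_zero p hp (by rw [h0, mixedCoeff_zero])]
  refine congrArg closure (Set.ext fun x => and_congr_right fun hx => ?_)
  exact initialIdeal_eq_iff hI hu hw hG hwu hx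

/-- The weighted degree of a fixed exponent, as a linear functional of the weight. -/
def weightedDegreeLinear (e : Fin (n + 1) →₀ ℕ) : (Fin (n + 1) → ℝ) →ₗ[ℝ] ℝ where
  toFun x := weightedDegree x e
  map_add' x y := by simpa using weightedDegree_add_smul x y 1 e
  map_smul' c x := by simp [weightedDegree, Finset.mul_sum, mul_assoc]

/-- The functional sums the differences `a - b` over `a` initial for `u` and `b` initial for `w`.
Each difference is nonnegative on the cone of `u`; if the sum vanishes, every such `b` ties with a
maximal `a`. -/
theorem isFace_initialCone (hu : u 0 < 0) (hw : w 0 < 0) (hG : G.Finite)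
    (hne : ∀ p ∈ G, (initialSupport u p.2).Nonempty) (hwu : w ∈ initialCone G u) :
    IsFace (initialCone G w) (initialCone G u) := by
  have happly : ∀ e x, weightedDegreeLinear (n := n) e x = weightedDegree x e := fun _ _ => rfl
  refine ⟨∑ p ∈ hG.toFinset, ∑ a ∈ (initialSupport_finite hu p.2).toFinset,
    ∑ b ∈ (initialSupport_finite hw p.2).toFinset,
      (weightedDegreeLinear a - weightedDegreeLinear b), ?_, ?_⟩
  · intro x hx
    simp only [LinearMap.sum_apply, LinearMap.sub_apply, happly]
    refine Finset.sum_nonneg fun p hp => Finset.sum_nonneg fun a ha =>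
      Finset.sum_nonneg fun b hb => sub_nonneg.2 ?_
    rw [Set.Finite.mem_toFinset] at hp ha hb
    exact hx.2 p hp a ha b hb.1
  · ext x
    constructor
    · intro hx
      refine ⟨⟨hx.1, fun p hp a ha b hb =>
        hx.2 p hp a (mem_initialSupport_of_mem_initialCone hwu hp ha) b hb⟩, ?_⟩
      simp only [LinearMap.sum_apply, LinearMap.sub_apply, happly]
      refine Finset.sum_eq_zero fun p hp => Finset.sum_eq_zero fun a ha =>
        Finset.sum_eq_zero fun b hb => sub_eq_zero.2 ?_
      rw [Set.Finite.mem_toFinset] at hp ha hb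
      have ha' := mem_initialSupport_of_mem_initialCone hwu hp ha
      exact le_antisymm (hx.2 p hp b hb a ha.1) (hx.2 p hp a ha' b hb.1)
    · rintro ⟨hx, h0⟩
      simp only [LinearMap.sum_apply, LinearMap.sub_apply, happly] at h0
      have hnonneg : ∀ p ∈ G, ∀ a ∈ initialSupport u p.2, ∀ b ∈ initialSupport w p.2,
          0 ≤ weightedDegree x a - weightedDegree x b := fun p hp a ha b hb =>
        sub_nonneg.2 (hx.2 p hp a ha b hb.1)
      refine ⟨hx.1, fun p hp b hb c hc => ?_⟩
      obtain ⟨a, ha⟩ := hne p hp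
      have h1 := (Finset.sum_eq_zero_iff_of_nonneg fun p hp => ?_).1 h0 p (by simpa using hp)
      · have h2 := (Finset.sum_eq_zero_iff_of_nonneg fun a ha => ?_).1 h1 a (by simpa using ha)
        · have h3 := (Finset.sum_eq_zero_iff_of_nonneg fun b hb => ?_).1 h2 b (by simpa using hb)
          · have := hx.2 p hp a ha c hc
            linarith
          · exact hnonneg p hp a ha b (by simpa using hb)
        · exact Finset.sum_nonneg fun b hb =>
            hnonneg p hp a (by simpa using ha) b (by simpa using hb)
      · exact Finset.sum_nonneg fun a ha => Finset.sum_nonneg fun b hb =>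
          hnonneg p (by simpa using hp) a (by simpa using ha) b (by simpa using hb)

theorem groebnerCone_structure [IsNoetherianRing R] (hI : IsXHomogeneous I) (hu : u 0 < 0) :
    (∀ x ∈ groebnerCone I u, ∀ y ∈ groebnerCone I u, x + y ∈ groebnerCone I u) ∧
      (∀ x ∈ groebnerCone I u, x 0 ≤ 0) ∧
      ∀ w ∈ groebnerCone I u, w 0 < 0 → IsFace (groebnerCone I w) (groebnerCone I u) := by
  obtain ⟨G, hG⟩ := exists_isReducedBasis ((TermOrder.lex n).isLocal_refine hu) I
  rw [groebnerCone_eq_initialCone hI hu hu hG (self_mem_initialCone hu)]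
  refine ⟨fun x hx y hy => initialCone_add hx hy, fun x hx => hx.1, fun w hw hw0 => ?_⟩
  rw [groebnerCone_eq_initialCone hI hu hw0 hG hw]
  exact isFace_initialCone hu hw0 hG.finite (fun p hp => initialSupport_nonempty hu
    (hG.isHeaded p hp).isHomogeneous fun h0 =>
      hG.mixedCoeff_ne_zero p hp (by rw [h0, mixedCoeff_zero])) hw

theorem self_mem_groebnerCone (hw : w 0 < 0) : w ∈ groebnerCone I w :=
  subset_closure ⟨hw, rfl⟩

end Cones

/-- A set closed under addition has a point, in the lower open half space, such that linear
functionals nonnegative on the set and vanishing at the point vanish on the whole set. -/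
theorem exists_interior_point {m : ℕ} {P : Set (Fin (m + 1) → ℝ)}
    (hadd : ∀ x ∈ P, ∀ y ∈ P, x + y ∈ P) (hneg : ∀ x ∈ P, x 0 ≤ 0)
    {p : Fin (m + 1) → ℝ} (hp : p ∈ P) (hp0 : p 0 < 0) :
    ∃ w ∈ P, w 0 < 0 ∧ ∀ l : (Fin (m + 1) → ℝ) →ₗ[ℝ] ℝ, (∀ x ∈ P, 0 ≤ l x) → l w = 0 →
      ∀ x ∈ P, l x = 0 := by
  classical
  -- The point is `p` plus the sum of a finite subset of `P` spanning the same subspace. A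
  -- functional nonnegative on `P` and zero at this sum vanishes on every summand, hence on the
  -- span; `p` makes coordinate 0 negative.
  obtain ⟨s, hsP, hs⟩ := (Submodule.fg_span_iff_fg_span_finset_subset P).1
    (IsNoetherian.noetherian (Submodule.span ℝ P))
  have hsum : ∀ t : Finset (Fin (m + 1) → ℝ), t ⊆ s →
      p + ∑ x ∈ t, x ∈ P := by
    intro t
    induction t using Finset.induction_on with
    | empty => exact fun _ => by simpa using hp
    | insert a t hat ih =>
      intro ht
      rw [Finset.sum_insert hat, add_left_comm]
      exact hadd _ (hsP (ht (Finset.mem_insert_self a t))) _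
        (ih ((Finset.subset_insert a t).trans ht))
  refine ⟨p + ∑ x ∈ s, x, hsum s subset_rfl, ?_, fun l hl hlw x hx => ?_⟩
  · rw [Pi.add_apply, Finset.sum_apply]
    have := Finset.sum_nonpos fun x hx => hneg x (hsP hx)
    linarith
  · rw [map_add, map_sum] at hlw
    have h1 := hl p hp
    have h2 : ∀ y ∈ s, 0 ≤ l y := fun y hy => hl y (hsP hy)
    have h3 := Finset.sum_nonneg h2
    have h4 := (Finset.sum_eq_zero_iff_of_nonneg h2).1 (by linarith)
    have h5 : Submodule.span ℝ P ≤ LinearMap.ker l := hs ▸ Submodule.span_le.2 h4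
    exact h5 (Submodule.subset_span hx)

end GroebnerFan

theorem proposition3p16 {R : Type*} [CommRing R] [IsNoetherianRing R] {n : ℕ}
    (I : Ideal (MvPolynomial (Fin n) (PowerSeries R)))
    (hI : GroebnerFan.IsXHomogeneous I)
    (u v : Fin (n + 1) → ℝ) (hu : u 0 < 0) (hv : v 0 < 0)
    (huv : ¬ (GroebnerFan.groebnerCone I u ∩ GroebnerFan.groebnerCone I v ⊆ {x | x 0 = 0})) :
    GroebnerFan.IsInteriorGroebnerCone I
        (GroebnerFan.groebnerCone I u ∩ GroebnerFan.groebnerCone I v) ∧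
      GroebnerFan.IsFace (GroebnerFan.groebnerCone I u ∩ GroebnerFan.groebnerCone I v)
        (GroebnerFan.groebnerCone I u) ∧
      GroebnerFan.IsFace (GroebnerFan.groebnerCone I u ∩ GroebnerFan.groebnerCone I v)
        (GroebnerFan.groebnerCone I v) := by
  obtain ⟨hadd_u, hneg_u, hface_u⟩ := GroebnerFan.groebnerCone_structure hI hu
  obtain ⟨hadd_v, -, hface_v⟩ := GroebnerFan.groebnerCone_structure hI hv
  obtain ⟨p, hp, hp0⟩ := Set.not_subset.1 huv
  obtain ⟨w, hw, hw0, hwl⟩ := GroebnerFan.exists_interior_point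
    (P := GroebnerFan.groebnerCone I u ∩ GroebnerFan.groebnerCone I v)
    (fun x hx y hy => ⟨hadd_u x hx.1 y hy.1, hadd_v x hx.2 y hy.2⟩)
    (fun x hx => hneg_u x hx.1) hp (lt_of_le_of_ne (hneg_u p hp.1) hp0)
  have hfu := hface_u w hw.1 hw0
  have hfv := hface_v w hw.2 hw0
  have heq : GroebnerFan.groebnerCone I u ∩ GroebnerFan.groebnerCone I v =
      GroebnerFan.groebnerCone I w := by
    obtain ⟨l, hl, hlF⟩ := hfu
    obtain ⟨l', -, hlF'⟩ := hfv
    refine Set.Subset.antisymm (fun x hx => ?_) fun x hx => ⟨?_, ?_⟩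
    -- `w` lies on the face it defines, so `l` vanishes there and thus on the whole intersection by
    -- the choice of `w`.
    · have hlw : l w = 0 := (hlF ▸ GroebnerFan.self_mem_groebnerCone hw0 :
        w ∈ {x ∈ GroebnerFan.groebnerCone I u | l x = 0}).2
      rw [hlF]
      exact ⟨hx.1, hwl l (fun y hy => hl y hy.1) hlw x hx⟩
    · rw [hlF] at hx
      exact hx.1
    · rw [hlF'] at hx
      exact hx.1
  rw [heq]
  exact ⟨⟨w, hw0, rfl⟩, hfu, hfv⟩
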